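/- Let $A$ be a finite set. For a set $F$ of maps $A\to A$ let $\mathrm{Con}(A,F)$ be the set of all equivalence relations $\kappa$ on $A$ with $(x,y)\in\kappa\Rightarrow (fx,fy)\in\kappa$ for all $f\in F$ and $x,y\in A$; write $\mathrm{Con}(A,f)$ for $\mathrm{Con}(A,\{f\})$. Let $\mathcal{E}=\{\mathrm{Con}(A,F)\mid F\subseteq A^A\}$ be the lattice of all these sets, ordered by inclusion (its meet is intersection). An element $L\in\mathcal{E}$ is meet-irreducible if it is not the greatest element of $\mathcal{E}$ and $L=L_1\cap L_2$ with $L_1,L_2\in\mathcal{E}$ implies $L=L_1$ or $L=L_2$. A map $A\to A$ is called trivial if it is the identity or constant, and $f\colon A\to A$ is called acyclic if for every $x\in A$ there is $n\ge 0$ with $f^n x=f^{n+1}x$ (equivalently, $f$ has no cycles except fixed points). Theorem. Let $f\colon A\to A$ be acyclic. Then $\mathrm{Con}(A,f)$ is meet-irreducible in $\mathcal{E}$ if and only if at least one of the following four conditions holds: (I) $f$ is nontrivial and $f^2=f$; (II) $f$ is nontrivial, $f^2$ is constant with value $z$, say, and the class of $z$ with respect to the kernel of $f$, that is $\{x\in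 A\mid fx=fz\}$, has at least three elements; (a) there are six distinct elements $0,1,2,0',1',2'\in A$ with $f2=1$, $f1=f0=0$, $f2'=1'$ and $f1'=f0'=0'$; (b) $f$ is connected (for all $x,y\in A$ there are $i,j\ge 0$ with $f^i x=f^j y$) and there are five distinct elements $0,1,2,1',2'\in A$ with $f2=1$, $f2'=1'$ and $f1=f1'=f0=0$. -/

import Mathlib

namespace MonounaryCon

variable {A : Type*}

/-- `Preserves f κ`: the map `f` preserves the equivalence relation `κ`. -/
def Preserves (f : A → A) (κ : Setoid A) : Prop :=
  ∀ x y : A, κ x y → κ (f x) (f y)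

/-- `Con F` is the set of all congruences of the unary algebra `(A, F)`, i.e. of all
equivalence relations on `A` that are preserved by every member of `F`. -/
def Con (F : Set (A → A)) : Set (Setoid A) :=
  {κ | ∀ f ∈ F, Preserves f κ}

/-- A map is trivial if it is the identity or constant. -/
def Trivial (f : A → A) : Prop :=
  f = id ∨ ∃ a : A, ∀ x : A, f x = a

/-- `f` is acyclic: iterating `f` from any element ends in a fixed point of `f`
(so that the depth of every element is defined). -/
def Acyclic (f : A → A) : Prop :=
  ∀ x : A, ∃ n : ℕ, f^[n] x = f^[n + 1] x

/-- The graph of `f` has only one connected component. -/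
def Connected (f : A → A) : Prop :=
  ∀ x y : A, ∃ i j : ℕ, f^[i] x = f^[j] y

/-- Type (I): `f` is nontrivial and `f² = f`. -/
def TypeI (f : A → A) : Prop :=
  ¬ Trivial f ∧ ∀ x : A, f (f x) = f x

/-- Type (II): `f` is nontrivial, `f²` is constant, say with value `z`, and the class of `z`
with respect to the kernel of `f` has at least three elements. -/
def TypeII (f : A → A) : Prop :=
  ¬ Trivial f ∧ ∃ z : A, (∀ x : A, f (f x) = z) ∧ 3 ≤ {x : A | f x = f z}.encard

/-- Condition (a): two disjoint tails `a₂ ↦ a₁ ↦ a₀ ↦ a₀` and `b₂ ↦ b₁ ↦ b₀ ↦ b₀`. -/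
def CondA (f : A → A) : Prop :=
  ∃ a₀ a₁ a₂ b₀ b₁ b₂ : A, [a₀, a₁, a₂, b₀, b₁, b₂].Nodup ∧
    f a₂ = a₁ ∧ f a₁ = a₀ ∧ f a₀ = a₀ ∧ f b₂ = b₁ ∧ f b₁ = b₀ ∧ f b₀ = b₀

/-- Condition (b): `f` is connected and there are two tails `a₂ ↦ a₁ ↦ c` and
`b₂ ↦ b₁ ↦ c` into the fixed point `c`, disjoint apart from `c`. -/
def CondB (f : A → A) : Prop :=
  Connected f ∧ ∃ c a₁ a₂ b₁ b₂ : A, [c, a₁, a₂, b₁, b₂].Nodup ∧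
    f a₂ = a₁ ∧ f b₂ = b₁ ∧ f b₁ = c ∧ f a₁ = c ∧ f c = c

variable (A) in
/-- The set `𝓔 = {Con (A, F) | F ⊆ A^A}` of all congruence lattices on `A`,
ordered by inclusion. -/
def CongLattices : Type _ :=
  {L : Set (Setoid A) // ∃ F : Set (A → A), L = Con F}

namespace CongLattices

/-- The order on `𝓔` is inclusion of sets of equivalence relations. -/
instance : PartialOrder (CongLattices A) :=
  inferInstanceAs (PartialOrder {L : Set (Setoid A) // ∃ F : Set (A → A), L = Con F})

/-- The element `Con (A, f)` of `𝓔`, for a single map `f`. -/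
def single (f : A → A) : CongLattices A :=
  ⟨Con {f}, {f}, rfl⟩

/-- Arbitrary intersections of members of `𝓔` are again members of `𝓔`. -/
theorem exists_iInter (S : Set (CongLattices A)) :
    ∃ F : Set (A → A), (⋂ L ∈ S, L.1) = Con F := by
  refine ⟨{f | ∃ L ∈ S, ∀ κ ∈ L.1, Preserves f κ}, ?_⟩
  ext κ
  simp only [Set.mem_iInter]
  constructor
  · rintro h f ⟨L, hL, hf⟩
    exact hf κ (h L hL)
  · intro h L hL
    obtain ⟨F, hF⟩ := L.2
    rw [hF]
    intro f hf
    refine h f ⟨L, hL, fun κ' hκ' => ?_⟩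
    rw [hF] at hκ'
    exact hκ' f hf

/-- The intersection of two members of `𝓔` is a member of `𝓔`. -/
theorem exists_inter (L M : CongLattices A) :
    ∃ F : Set (A → A), L.1 ∩ M.1 = Con F := by
  obtain ⟨F, hF⟩ := exists_iInter {L, M}
  exact ⟨F, by rw [← hF]; simp⟩

instance : InfSet (CongLattices A) :=
  ⟨fun S => ⟨⋂ L ∈ S, L.1, exists_iInter S⟩⟩

theorem isGLB_sInf' (S : Set (CongLattices A)) : IsGLB S (sInf S) := by
  constructor
  · intro L hL
    exact Set.biInter_subset_of_mem (t := fun L : CongLattices A => L.1) hL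
  · intro M hM
    exact Set.subset_iInter₂ fun L hL => hM hL

/-- `𝓔` is a (complete) lattice, whose meets are intersections. -/
instance : CompleteLattice (CongLattices A) where
  __ := completeLatticeOfInf (CongLattices A) isGLB_sInf'
  inf L M := ⟨L.1 ∩ M.1, exists_inter L M⟩
  inf_le_left _ _ := Set.inter_subset_left
  inf_le_right _ _ := Set.inter_subset_right
  le_inf _ _ _ h₁ h₂ := Set.subset_inter h₁ h₂

end CongLattices

end MonounaryCon

namespace MonounaryCon

open CongLattices

variable {A : Type*} {f g : A → A}

/-! Every member of 𝓔 is an intersection of sets `Con {g}`. Hence `single f` is meet-irreducible as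
soon as a single relation κ outside `Con {f}` lies in every `Con {g}` that properly contains `Con
{f}` (`infIrred_of_separating`). In all four cases a two-element block serves as κ. Preserving the
congruences of `f` leaves `g` few possible values on a few chosen points, and violating κ cuts them
down further; comparing any other point with these determines `g`. Under (a) and (b) this forces `g
= f`: a tail of length two on which `g` agrees with `f` transfers the agreement to every point whose
own tail avoids it (`Dom.eq_of_tail`), and two tails suffice to serve every point. Under (I) and
(II) a few other `g` survive, but each has `Con {g} ⊆ Con {f}`.

Conversely, let `f` be nontrivial with `f² ≠ f`. Acyclicity gives a path `a ↦ d ↦ c` ending in a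
fixed point `c`, with `d ≠ c`. If none of the conditions holds, there are three possibilities: all
other components have depth at most one; or `f` is connected, `d` is the only depth-one point with a
preimage, and some point has depth at least three; or `f²` is constant and the kernel class of `c`
is `{c, d}`. In each, two explicit maps built from `f` have strictly larger congruence sets
intersecting in `Con {f}` (`not_infIrred_of_two`). -/

/-- The equivalence relation whose only nontrivial classes are among three disjoint sets. -/
def blocks (S₁ S₂ S₃ : Set A) (h₁₂ : ∀ x ∈ S₁, x ∉ S₂) (h₁₃ : ∀ x ∈ S₁, x ∉ S₃)
    (h₂₃ : ∀ x ∈ S₂, x ∉ S₃) : Setoid A where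
  r x y := x = y ∨ (x ∈ S₁ ∧ y ∈ S₁) ∨ (x ∈ S₂ ∧ y ∈ S₂) ∨ (x ∈ S₃ ∧ y ∈ S₃)
  iseqv := ⟨fun _ => Or.inl rfl, by grind, by grind⟩

/-- The equivalence relation whose only nontrivial class is `{a, b}`. -/
def pair (a b : A) : Setoid A :=
  blocks ∅ ∅ {a, b} (by simp) (by simp) (by simp)

theorem pair_apply {a b x y : A} :
    pair a b x y ↔ x = y ∨ ((x = a ∨ x = b) ∧ (y = a ∨ y = b)) := by
  change (_ ∨ _) ↔ _
  simp

theorem preserves_pair {a b : A} :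
    Preserves f (pair a b) ↔
      f a = f b ∨ ((f a = a ∨ f a = b) ∧ (f b = a ∨ f b = b)) := by
  constructor
  · intro h
    exact pair_apply.1 (h a b (pair_apply.2 (by simp)))
  · intro h x y hxy
    rw [pair_apply] at hxy ⊢
    grind

/-- The blocks form a chain `S₁ → S₂ → S₃ → S₃` under `f`, the shape of a tail of depth two. Shorter
chains arise by leaving the first blocks empty. -/
theorem preserves_blocks {S₁ S₂ S₃ : Set A} (h₁₂ : ∀ x ∈ S₁, x ∉ S₂) (h₁₃ : ∀ x ∈ S₁, x ∉ S₃)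
    (h₂₃ : ∀ x ∈ S₂, x ∉ S₃) (m₁ : ∀ x ∈ S₁, f x ∈ S₂) (m₂ : ∀ x ∈ S₂, f x ∈ S₃)
    (m₃ : ∀ x ∈ S₃, f x ∈ S₃) : Preserves f (blocks S₁ S₂ S₃ h₁₂ h₁₃ h₂₃) := by
  rintro x y (h | h | h | h)
  · exact Or.inl (congrArg f h)
  · exact Or.inr (Or.inr (Or.inl ⟨m₁ _ h.1, m₁ _ h.2⟩))
  · exact Or.inr (Or.inr (Or.inr ⟨m₂ _ h.1, m₂ _ h.2⟩))
  · exact Or.inr (Or.inr (Or.inr ⟨m₃ _ h.1, m₃ _ h.2⟩))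

/-- `Dom f g`: the map `g` preserves all congruences of `f`. -/
def Dom (f g : A → A) : Prop :=
  ∀ κ : Setoid A, Preserves f κ → Preserves g κ

theorem Dom.blocks₁ (hg : Dom f g) (S₁ S₂ S₃ : Set A) {x y : A} (hx : x ∈ S₁) (hy : y ∈ S₁)
    (h₁₂ : ∀ x ∈ S₁, x ∉ S₂) (h₁₃ : ∀ x ∈ S₁, x ∉ S₃)
    (h₂₃ : ∀ x ∈ S₂, x ∉ S₃) (m₁ : ∀ x ∈ S₁, f x ∈ S₂) (m₂ : ∀ x ∈ S₂, f x ∈ S₃)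
    (m₃ : ∀ x ∈ S₃, f x ∈ S₃) :
    g x = g y ∨ (g x ∈ S₁ ∧ g y ∈ S₁) ∨ (g x ∈ S₂ ∧ g y ∈ S₂) ∨ (g x ∈ S₃ ∧ g y ∈ S₃) :=
  hg _ (preserves_blocks h₁₂ h₁₃ h₂₃ m₁ m₂ m₃) x y (Or.inr (Or.inl ⟨hx, hy⟩))

theorem Dom.blocks₂ (hg : Dom f g) (S₂ S₃ : Set A) {x y : A} (hx : x ∈ S₂) (hy : y ∈ S₂)
    (h₂₃ : ∀ x ∈ S₂, x ∉ S₃) (m₂ : ∀ x ∈ S₂, f x ∈ S₃) (m₃ : ∀ x ∈ S₃, f x ∈ S₃) :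
    g x = g y ∨ (g x ∈ S₂ ∧ g y ∈ S₂) ∨ (g x ∈ S₃ ∧ g y ∈ S₃) := by
  have := hg (blocks ∅ S₂ S₃ (by simp) (by simp) h₂₃)
    (preserves_blocks _ _ _ (by simp) m₂ m₃) x y (Or.inr (Or.inr (Or.inl ⟨hx, hy⟩)))
  change (_ ∨ _) at this
  simpa using this

theorem Dom.blocks₃ (hg : Dom f g) (S : Set A) {x y : A} (hx : x ∈ S) (hy : y ∈ S)
    (m : ∀ x ∈ S, f x ∈ S) : g x = g y ∨ (g x ∈ S ∧ g y ∈ S) := by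
  have := hg (blocks ∅ ∅ S (by simp) (by simp) (by simp))
    (preserves_blocks _ _ _ (by simp) (by simp) m) x y (Or.inr (Or.inr (Or.inr ⟨hx, hy⟩)))
  change (_ ∨ _) at this
  simpa using this

/-! ### Criteria for meet-irreducibility -/

theorem mem_single {κ : Setoid A} : κ ∈ (single f).1 ↔ Preserves f κ := by
  change (∀ g ∈ ({f} : Set (A → A)), Preserves g κ) ↔ _
  simp

theorem single_le_single : single f ≤ single g ↔ Dom f g := by
  constructor
  · intro h κ hκ
    exact mem_single.1 (h (mem_single.2 hκ))
  · intro h κ hκ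
    exact mem_single.2 (h κ (mem_single.1 hκ))

/-- A relation separating `Con (A, f)` from all strictly larger `Con (A, g)` witnesses
meet-irreducibility. -/
theorem infIrred_of_separating {κ : Setoid A} (hκ : ¬ Preserves f κ)
    (h : ∀ g, Dom f g → ¬ Preserves g κ → Dom g f) : InfIrred (single f) := by
  have key : ∀ b : CongLattices A, single f ≤ b → κ ∉ b.1 → b = single f := by
    intro b hb hκb
    obtain ⟨F, hF⟩ := b.2
    rw [hF] at hκb
    simp only [Con, Set.mem_ofPred_eq, not_forall] at hκb
    obtain ⟨g, hgF, hgκ⟩ := hκb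
    have hbg : b ≤ single g := fun τ hτ => by
      rw [hF] at hτ
      exact mem_single.2 (hτ g hgF)
    exact le_antisymm
      (hbg.trans (single_le_single.2 (h g (single_le_single.1 (hb.trans hbg)) hgκ))) hb
  refine ⟨fun hmax => hκ ?_, fun b c hbc => ?_⟩
  -- `Con ∅` contains every equivalence relation, so maximality of `single f` would put κ into it.
  · have htop : single f ≤ (⟨Con ∅, ∅, rfl⟩ : CongLattices A) := fun τ _ g hg => hg.elim
    exact mem_single.1 (hmax htop fun g hg => hg.elim)
  · have hnot : ¬ (κ ∈ b.1 ∧ κ ∈ c.1) := fun hbcκ => hκ (by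
      rw [← mem_single, ← hbc]
      exact hbcκ)
    rw [not_and_or] at hnot
    exact hnot.imp (key b (hbc ▸ inf_le_left)) (key c (hbc ▸ inf_le_right))

theorem not_infIrred_of_two {g₁ g₂ : A → A} (h₁ : Dom f g₁) (h₂ : Dom f g₂)
    (n₁ : ¬ Dom g₁ f) (n₂ : ¬ Dom g₂ f)
    (h : ∀ κ, Preserves g₁ κ → Preserves g₂ κ → Preserves f κ) :
    ¬ InfIrred (single f) := by
  intro hirr
  have heq : single g₁ ⊓ single g₂ = single f := by
    refine le_antisymm (fun κ hκ => ?_) (le_inf (single_le_single.2 h₁) (single_le_single.2 h₂))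
    exact mem_single.2 (h κ (mem_single.1 hκ.1) (mem_single.1 hκ.2))
  rcases hirr.2 heq with e | e
  · exact n₁ (single_le_single.1 e.le)
  · exact n₂ (single_le_single.1 e.le)

theorem not_infIrred_of_trivial (hf : Trivial f) : ¬ InfIrred (single f) := by
  intro hirr
  refine hirr.1 fun b _ κ _ => mem_single.2 fun x y hxy => ?_
  rcases hf with rfl | ⟨a, ha⟩
  · exact hxy
  · rw [ha, ha]

/-! ### Iterates and acyclic maps -/

theorem Preserves.iterate {κ : Setoid A} (h : Preserves f κ) (n : ℕ) : Preserves f^[n] κ := by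
  induction n with
  | zero => exact fun x y hxy => hxy
  | succ n ih =>
    intro x y hxy
    rw [Function.iterate_succ_apply', Function.iterate_succ_apply']
    exact h _ _ (ih x y hxy)

theorem Acyclic.fixed_of_iterate_eq (hf : Acyclic f) {x : A} {n : ℕ} (hn : 0 < n)
    (h : f^[n] x = x) : f x = x := by
  obtain ⟨m, hm⟩ := hf x
  have hfix : f (f^[m] x) = f^[m] x := by
    have := Function.iterate_succ_apply' f m x
    grind
  -- Running `m` times around the supposed cycle takes `n * m ≥ m` steps, by which time the orbit
  -- rests at the fixed point `f^[m] x`.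
  have hx : f^[n * m] x = x := by
    rw [Function.iterate_mul]
    exact Function.iterate_fixed h m
  have hx' : f^[n * m] x = f^[m] x := by
    obtain ⟨k, hk⟩ := Nat.exists_eq_add_of_le' (Nat.le_mul_of_pos_left m hn)
    rw [hk, Function.iterate_add_apply]
    exact Function.iterate_fixed hfix k
  rw [← hx, hx', hfix]

/-! ### Type (I) -/

theorem TypeI.infIrred (hf : TypeI f) : InfIrred (single f) := by
  obtain ⟨hnt, hff⟩ := hf
  simp only [Trivial, not_or, not_exists, not_forall] at hnt
  obtain ⟨hid, hc⟩ := hnt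
  obtain ⟨x, hx⟩ := Function.ne_iff.1 hid
  obtain ⟨y, hy⟩ := hc (f x)
  obtain ⟨r, hr⟩ : ∃ r, r = f x := ⟨_, rfl⟩
  obtain ⟨s, hs⟩ : ∃ s, s = f y := ⟨_, rfl⟩
  simp only [id] at hx
  have hfr : f r = r := by rw [hr, hff]
  have hfs : f s = s := by rw [hs, hff]
  rw [← hr, ← hs] at hy
  rw [← hr] at hx
  have hxs : x ≠ s := by grind
  have hxκ : ¬ Preserves f (pair x s) := by
    rw [preserves_pair]
    grind
  refine infIrred_of_separating hxκ fun g hg hgκ => ?_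
  rw [preserves_pair] at hgκ
  have e₁ := hg.blocks₃ {x, r, s} (x := x) (y := s) (by grind) (by grind) (by grind)
  have e₂ := hg.blocks₃ {x, r} (x := x) (y := r) (by grind) (by grind) (by grind)
  have e₃ := hg.blocks₃ {r, s} (x := r) (y := s) (by grind) (by grind) (by grind)
  have fixing : ∀ t u, f t = t → f u = u → g t = g u ∨ (g t = t ∨ g t = u) ∧ (g u = t ∨ g u = u) :=
    fun t u ht hu => by
      have := hg.blocks₃ {t, u} (x := t) (y := u) (by grind) (by grind) (by grind)
      grind
  have moved : ∀ t, g t = g (f t) ∨ (g t = t ∨ g t = f t) ∧ (g (f t) = t ∨ g (f t) = f t) :=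
    fun t => by
      have := hg.blocks₃ {t, f t} (x := t) (y := f t) (by grind) (by grind) (by grind)
      grind
  have moved₂ : ∀ t, t ≠ f t → g t = g x ∨ (g t = t ∨ g t = x) ∧ (g x = t ∨ g x = x) ∨
      (g t = f t ∨ g t = r) ∧ (g x = f t ∨ g x = r) := fun t ht => by
    have := hg.blocks₂ {t, x} {f t, r} (x := t) (y := x) (by grind) (by grind) (by grind) (by grind)
      (by grind)
    grind
  -- Four behaviours survive, and they extend to all points as follows: `f = g ∘ g` with `r`, `s`
  -- the only fixed points; `g = f`; `g` fixes every moved point and collapses the fixed points to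
  -- `r`; or `x` is the only moved point, `g x = r`, and all fixed points go to `x`. In the last
  -- two, applying `g` to a pair of a moved and a fixed point relates the moved point to `r`, which
  -- is what `f` needs.
  have cases : (g x = s ∧ g s = r ∧ g r = s) ∨ (g x = r ∧ g s = s ∧ g r = r) ∨
      (g x = x ∧ g s = r ∧ g r = r) ∨ (g x = r ∧ g s = x ∧ g r = x) := by grind
  rcases cases with ⟨gx, gs, gr⟩ | ⟨gx, gs, gr⟩ | ⟨gx, gs, gr⟩ | ⟨gx, gs, gr⟩
  · have hfix : ∀ t, f t = t → t = r ∨ t = s := fun t ht => by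
      have := fixing t r ht hfr
      have := fixing t s ht hfs
      grind
    have hgg : ∀ t, f t = g (g t) := fun t => by
      have := hfix (f t) (hff t)
      have := moved t
      grind
    intro κ hκ u v huv
    rw [hgg, hgg]
    exact hκ _ _ (hκ _ _ huv)
  · have hfix : ∀ t, f t = t → g t = t := fun t ht => by
      have := fixing t r ht hfr
      have := fixing t s ht hfs
      grind
    have hgf : ∀ t, f t = g t := fun t => by
      have := hfix (f t) (hff t)
      have := moved t
      by_cases ht : t = f t
      · grind
      · have := moved₂ t ht
        grind
    intro κ hκ u v huv
    rw [hgf, hgf]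
    exact hκ _ _ huv
  · have hfix : ∀ t, f t = t → g t = r := fun t ht => by
      have := fixing t r ht hfr
      have := fixing t s ht hfs
      grind
    have hmov : ∀ t, f t ≠ t → f t = r ∧ g t = t := fun t ht => by
      have := hfix (f t) (hff t)
      have := moved t
      have := moved₂ t (Ne.symm ht)
      grind
    have mixed : ∀ κ : Setoid A, Preserves g κ → ∀ u v, κ u v → f u ≠ u → f v = v →
        κ (f u) (f v) := fun κ hκ u v huv hu hv => by
      have h := hκ u v huv
      rw [(hmov u hu).2, hfix v hv] at h
      rw [(hmov u hu).1, hv]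
      exact κ.trans (κ.symm h) huv
    intro κ hκ u v huv
    by_cases hu : f u = u <;> by_cases hv : f v = v
    · rwa [hu, hv]
    · exact κ.symm (mixed κ hκ v u (κ.symm huv) hv hu)
    · exact mixed κ hκ u v huv hu hv
    · rw [(hmov u hu).1, (hmov v hv).1]
  · have hfix : ∀ t, f t = t → g t = x := fun t ht => by
      have := fixing t r ht hfr
      have := fixing t s ht hfs
      grind
    have hmov : ∀ t, f t ≠ t → t = x := fun t ht => by
      have := hfix (f t) (hff t)
      have := moved t
      have := moved₂ t (Ne.symm ht)
      grind
    have mixed : ∀ κ : Setoid A, Preserves g κ → ∀ v, κ x v → f v = v → κ r v :=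
      fun κ hκ v huv hv => by
      have h := hκ x v huv
      rw [gx, hfix v hv] at h
      exact κ.trans h huv
    intro κ hκ u v huv
    by_cases hu : f u = u <;> by_cases hv : f v = v
    · rwa [hu, hv]
    · obtain rfl := hmov v hv
      rw [hu, ← hr]
      exact κ.symm (mixed κ hκ u (κ.symm huv) hu)
    · obtain rfl := hmov u hu
      rw [hv, ← hr]
      exact mixed κ hκ v huv hv
    · rw [hmov u hu, hmov v hv]

/-! ### Images of small congruence classes -/

section
variable {u v z : A}

theorem Dom.apply_depth₁ (hg : Dom f g) (hz : f z = z) (hu : f u = z) :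
    g u = g z ∨ (g u = u ∨ g u = z) ∧ (g z = u ∨ g z = z) := by
  have := hg.blocks₃ {u, z} (x := u) (y := z) (by grind) (by grind) (by grind)
  grind

theorem Dom.apply_depth₁₁ (hg : Dom f g) (hz : f z = z) (hu : f u = z) (hv : f v = z)
    (huz : u ≠ z) (hvz : v ≠ z) :
    g u = g v ∨ (g u = u ∨ g u = v) ∧ (g v = u ∨ g v = v) ∨ g u = z ∧ g v = z := by
  have := hg.blocks₂ {u, v} {z} (x := u) (y := v) (by grind) (by grind) (by grind) (by grind)
    (by grind)
  grind

theorem Dom.apply_depth₂ (hg : Dom f g) (hz : f z = z) (hu : f (f u) = z) :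
    g u = g z ∨ (g u = u ∨ g u = f u ∨ g u = z) ∧ (g z = u ∨ g z = f u ∨ g z = z) := by
  have := hg.blocks₃ {u, f u, z} (x := u) (y := z) (by grind) (by grind) (by grind)
  grind

theorem Dom.apply_edge (hg : Dom f g) (hz : f z = z) (hu : f (f u) = z) :
    g u = g (f u) ∨
      (g u = u ∨ g u = f u ∨ g u = z) ∧ (g (f u) = u ∨ g (f u) = f u ∨ g (f u) = z) := by
  have := hg.blocks₃ {u, f u, z} (x := u) (y := f u) (by grind) (by grind) (by grind)
  grind

theorem Dom.apply_depth₂₁ (hg : Dom f g) (hz : f z = z) (hu : f (f u) = z) (hv : f v = z)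
    (huz : f u ≠ z) (huv : f u ≠ v) (hvz : v ≠ z) :
    g u = g v ∨ (g u = u ∨ g u = v) ∧ (g v = u ∨ g v = v) ∨
      (g u = f u ∨ g u = z) ∧ (g v = f u ∨ g v = z) := by
  have := hg.blocks₂ {u, v} {f u, z} (x := u) (y := v) (by grind) (by grind) (by grind)
    (by grind) (by grind)
  grind

theorem Dom.apply_depth₂₂ (hg : Dom f g) (hz : f z = z) (hu : f (f u) = z) (hv : f (f v) = z)
    (huz : f u ≠ z) (hvz : f v ≠ z) :
    g u = g v ∨ (g u = u ∨ g u = v) ∧ (g v = u ∨ g v = v) ∨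
      (g u = f u ∨ g u = f v) ∧ (g v = f u ∨ g v = f v) ∨ g u = z ∧ g v = z := by
  have := hg.blocks₁ {u, v} {f u, f v} {z} (x := u) (y := v) (by grind) (by grind) (by grind)
    (by grind) (by grind) (by grind) (by grind) (by grind)
  grind

end

/-! ### Type (II) -/

theorem TypeII.infIrred (hf : TypeII f) : InfIrred (single f) := by
  obtain ⟨hnt, z, hff, hcard⟩ := hf
  simp only [Trivial, not_or, not_exists, not_forall] at hnt
  obtain ⟨-, hc⟩ := hnt
  have hz : f z = z := by
    have := hff (f z)
    have := hff z
    grind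
  obtain ⟨x, hx⟩ := hc z
  obtain ⟨a, ha⟩ : ∃ a, a = f x := ⟨_, rfl⟩
  rw [← ha] at hx
  have hfa : f a = z := by rw [ha, hff]
  -- The kernel class of `z` already contains `a` and `z`; its third element supplies the separating
  -- pair.
  obtain ⟨d, hd, hda, hdz⟩ : ∃ d, f d = z ∧ d ≠ a ∧ d ≠ z := by
    by_contra! hno
    have hsub : {x : A | f x = f z} ⊆ {a, z} := fun t (ht : f t = f z) => by
      have := hno t (ht.trans hz)
      by_cases h : t = a
      · exact Or.inl h
      · exact Or.inr (this h)
    have := (hcard.trans (Set.encard_le_encard hsub)).trans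
      (Set.encard_insert_le {z} a)
    rw [Set.encard_singleton] at this
    exact absurd this (by norm_num)
  have hκ : ¬ Preserves f (pair x d) := by
    rw [preserves_pair]
    grind
  refine infIrred_of_separating hκ fun g hg hgκ => ?_
  rw [preserves_pair] at hgκ
  have depth₁ := fun t ht => hg.apply_depth₁ (u := t) hz ht
  have depth₁₁ := fun t u ht hu => hg.apply_depth₁₁ (u := t) (v := u) hz ht hu
  have depth₂ := fun t => hg.apply_depth₂ (u := t) hz (hff t)
  have depth₂₁ := fun t u hu => hg.apply_depth₂₁ (u := t) (v := u) hz (hff t) hu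
  have depth₂₂ : ∀ t, f t ≠ z → g t = g x ∨ (g t = t ∨ g t = x) ∧ (g x = t ∨ g x = x) ∨
      (g t = f t ∨ g t = a) ∧ (g x = f t ∨ g x = a) ∨ g t = z ∧ g x = z := fun t ht => by
    have := hg.apply_depth₂₂ (u := t) (v := x) hz (hff t) (hff x) ht (ha ▸ hx)
    rwa [← ha] at this
  clear hff hg
  have e₁ := depth₂₁ x d hd (ha ▸ hx) (ha ▸ hda.symm) hdz
  have e₂ := depth₂ x
  have e₃ := depth₁ d hd
  have e₄ := depth₁ a hfa
  have e₅ := depth₁₁ a d hfa hd hx hdz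
  -- Either `g` is `f`, or `g` is `f` followed by the transposition of `a` and `z`. In the second
  -- case `f` and `g` have the same kernel, and a congruence of `g` relating points of different
  -- kernel classes identifies `a` with `z`, hence the whole image of `f`.
  have cases : (g x = a ∧ g d = z ∧ g z = z ∧ g a = z) ∨
      (g x = z ∧ g d = a ∧ g z = a ∧ g a = a) := by
    clear depth₁ depth₁₁ depth₂ depth₂₁ depth₂₂
    grind
  rcases cases with ⟨gx, gd, gz, ga⟩ | ⟨gx, gd, gz, ga⟩
  · have hgf : ∀ t, f t = g t := fun t => by
      by_cases ht : f t = z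
      · by_cases htz : t = z
        · grind
        · have := depth₁ t ht
          have := depth₁₁ t d ht hd htz hdz
          have := depth₁₁ t a ht hfa htz hx
          clear depth₁ depth₁₁ depth₂ depth₂₁ depth₂₂
          grind
      · have := depth₂ t
        have := depth₂₂ t ht
        by_cases h : f t = d
        · have := depth₂₁ t a hfa ht (h ▸ hda) hx
          grind
        · have := depth₂₁ t d hd ht h hdz
          grind
    intro κ hκ u v huv
    rw [hgf, hgf]
    exact hκ _ _ huv
  · have h₁ : ∀ t, f t = z → g t = a := fun t ht => by
      have := depth₁ t ht
      by_cases htz : t = z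
      · grind
      · have := depth₁₁ t d ht hd htz hdz
        have := depth₁₁ t a ht hfa htz hx
        clear depth₁ depth₁₁ depth₂ depth₂₁ depth₂₂
        grind
    have h₂ : ∀ t, f t ≠ z → g t = z ∧ f t = a := fun t ht => by
      have := depth₂ t
      have := depth₂₂ t ht
      clear depth₁ depth₁₁ depth₂ depth₂₁ depth₂₂
      grind
    have h₃ : ∀ κ : Setoid A, κ z a → ∀ u v, κ (f u) (f v) := fun κ h u v => by
      have : ∀ u, κ (f u) z := fun u => by
        by_cases hu : f u = z
        · rw [hu]
        · rw [(h₂ u hu).2]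
          exact κ.symm h
      exact κ.trans (this u) (κ.symm (this v))
    intro κ hκ u v huv
    have h := hκ u v huv
    by_cases hu : f u = z <;> by_cases hv : f v = z
    · rw [hu, hv]
    · rw [h₁ u hu, (h₂ v hv).1] at h
      exact h₃ κ (κ.symm h) u v
    · rw [h₁ v hv, (h₂ u hu).1] at h
      exact h₃ κ h u v
    · rw [(h₂ u hu).2, (h₂ v hv).2]

/-! ### Two tails of length two -/

/-- The set of all iterated images of `x`. -/
def tail (f : A → A) (x : A) : Set A :=
  Set.range fun n => f^[n] x

theorem mem_tail_self (x : A) : x ∈ tail f x :=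
  ⟨0, rfl⟩

theorem apply_mem_tail {x y : A} (h : y ∈ tail f x) : f y ∈ tail f x := by
  obtain ⟨n, rfl⟩ := h
  exact ⟨n + 1, Function.iterate_succ_apply' f n x⟩

theorem mem_tail_iff {x y : A} : y ∈ tail f x ↔ y = x ∨ y ∈ tail f (f x) := by
  constructor
  · rintro ⟨n, rfl⟩
    cases n with
    | zero => exact Or.inl rfl
    | succ n => exact Or.inr ⟨n, rfl⟩
  · rintro (rfl | ⟨n, rfl⟩)
    · exact mem_tail_self _
    · exact ⟨n + 1, rfl⟩

theorem Acyclic.fixed_of_mem_tail (hf : Acyclic f) {x : A} (h : x ∈ tail f (f x)) : f x = x := by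
  obtain ⟨n, hn⟩ := h
  exact hf.fixed_of_iterate_eq (Nat.succ_pos n) hn

theorem tail_of_fixed {x y : A} (h : f x = x) (hy : y ∈ tail f x) : y = x := by
  obtain ⟨n, rfl⟩ := hy
  exact Function.iterate_fixed h n

/-- A map preserving all congruences of `f` that agrees with `f` on a tail of length two
agrees with `f` at all elements whose tail does not run through it. -/
theorem Dom.eq_of_tail (hf : Acyclic f) (hg : Dom f g) {a₀ a₁ a₂ x : A} (h₂ : f a₂ = a₁)
    (h₁ : f a₁ = a₀) (h₀ : f a₀ = a₀) (ne : a₁ ≠ a₀) (g₂ : g a₂ = a₁) (g₁ : g a₁ = a₀)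
    (g₀ : g a₀ = a₀) (ha₁ : a₁ ∉ tail f x) (hgx : g x ∈ tail f x) : g x = f x := by
  have ha₂ : a₂ ∉ tail f x := fun h => ha₁ (h₂ ▸ apply_mem_tail h)
  have hsub : ∀ y, y ∈ tail f (f x) → y ∈ tail f x := fun y hy => mem_tail_iff.2 (Or.inr hy)
  have hsub₂ : ∀ y, y ∈ tail f (f (f x)) → y ∈ tail f (f x) :=
    fun y hy => mem_tail_iff.2 (Or.inr hy)
  have hsucc : ∀ y z, y ∈ tail f z → f y ∈ tail f z := fun y z => apply_mem_tail
  have hx := mem_tail_self (f := f) x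
  have hfx := mem_tail_self (f := f) (f x)
  have hffx := mem_tail_self (f := f) (f (f x))
  have hcyc := hf.fixed_of_mem_tail (x := x)
  have hcyc₁ := hf.fixed_of_mem_tail (x := f x)
  by_cases hfix : f x = x
  · rw [hfix]
    exact tail_of_fixed hfix hgx
  by_cases hfix₁ : f (f x) = f x
  · have hfix₂ : ∀ y ∈ tail f (f x), y = f x := fun y => tail_of_fixed hfix₁
    have := mem_tail_iff.1 hgx
    have := hg.blocks₂ {x, a₁} {f x, a₀} (x := x) (y := a₁) (by grind) (by grind) (by grind)
      (by grind) (by grind)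
    grind
  -- As `g a₂ = a₁` lies in the middle block, `g x` is `f x` or `a₁`, and `a₁` is not on the tail of
  -- `x`. Acyclicity keeps `x` and `f x` out of the last block.
  · have h3 := hg.blocks₁ {x, a₂} {f x, a₁} (tail f (f (f x)) ∪ {a₀}) (x := x) (y := a₂)
      (by grind) (by grind) (by grind) (by grind) (by grind) (by grind) (by grind) (by grind)
    grind

theorem mem_tail_or_mem_tail {x y z : A} (hy : y ∈ tail f x) (hz : z ∈ tail f x) :
    y ∈ tail f z ∨ z ∈ tail f y := by
  obtain ⟨m, rfl⟩ := hy
  obtain ⟨n, rfl⟩ := hz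
  rcases le_total m n with h | h
  · obtain ⟨k, rfl⟩ := Nat.exists_eq_add_of_le' h
    exact Or.inr ⟨k, (Function.iterate_add_apply f k m x).symm⟩
  · obtain ⟨k, rfl⟩ := Nat.exists_eq_add_of_le' h
    exact Or.inl ⟨k, (Function.iterate_add_apply f k n x).symm⟩

theorem Dom.of_eq (h : ∀ x, g x = f x) : Dom g f := by
  intro κ hκ x y hxy
  rw [← h, ← h]
  exact hκ x y hxy

/-- The hypothesis `h` says that `g` violates `pair a₂ a₁`. On the closed set `{a₂, a₁, a₀}` this
means that exactly one of `g a₂`, `g a₁` is `a₀`, leaving four cases; blocks mixing the two tails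
rule out all but the one agreeing with `f`. -/
theorem Dom.eq_on_disjoint_tails (hg : Dom f g) {a₀ a₁ a₂ b₀ b₁ b₂ : A}
    (hnd : [a₀, a₁, a₂, b₀, b₁, b₂].Nodup) (ha₂ : f a₂ = a₁) (ha₁ : f a₁ = a₀) (ha₀ : f a₀ = a₀)
    (hb₂ : f b₂ = b₁) (hb₁ : f b₁ = b₀) (hb₀ : f b₀ = b₀)
    (h : ¬ (g a₂ = g a₁ ∨ (g a₂ = a₂ ∨ g a₂ = a₁) ∧ (g a₁ = a₂ ∨ g a₁ = a₁))) :
    (g a₂ = a₁ ∧ g a₁ = a₀ ∧ g a₀ = a₀) ∧ g b₂ = b₁ ∧ g b₁ = b₀ ∧ g b₀ = b₀ := by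
  simp only [List.nodup_cons, List.mem_cons, List.not_mem_nil, or_false, not_or, List.nodup_nil,
    and_true, not_false_eq_true] at hnd
  have e₁ := hg.blocks₁ {a₂, b₂} {a₁, b₁} {a₀, b₀} (x := a₂) (y := b₂) (by grind) (by grind)
    (by grind) (by grind) (by grind) (by grind) (by grind) (by grind)
  have e₂ := hg.blocks₂ {a₁, b₁} {a₀, b₀} (x := a₁) (y := b₁) (by grind) (by grind)
    (by clear e₁; grind) (by clear e₁; grind) (by clear e₁; grind)
  have e₃ := hg.blocks₃ {a₀, b₀} (x := a₀) (y := b₀) (by grind) (by grind)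
    (by clear e₁ e₂; grind)
  have e₇ := hg.blocks₃ {b₀, a₁, a₀} (x := b₀) (y := a₁) (by grind) (by grind)
    (by clear e₁ e₂ e₃; grind)
  have e₈ := hg.blocks₂ {a₂, b₁} {a₁, b₀, a₀} (x := a₂) (y := b₁) (by grind) (by grind)
    (by clear e₁ e₂ e₃ e₇; grind) (by clear e₁ e₂ e₃ e₇; grind) (by clear e₁ e₂ e₃ e₇; grind)
  have e₄ := hg.apply_edge hb₀ (u := b₂) (by rw [hb₂, hb₁])
  have e₅ := hg.apply_depth₁ ha₀ ha₁
  have e₆ := hg.apply_depth₁ hb₀ hb₁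
  have e₉ := hg.apply_edge ha₀ (u := a₂) (by rw [ha₂, ha₁])
  rw [hb₂] at e₄
  rw [ha₂] at e₉
  simp only [Set.mem_insert_iff, Set.mem_singleton_iff] at e₁ e₂ e₃ e₇ e₈
  have cases : (g a₂ = a₁ ∧ g a₁ = a₀) ∨ (g a₂ = a₀ ∧ g a₁ = a₁) ∨ (g a₂ = a₂ ∧ g a₁ = a₀) ∨
      (g a₂ = a₀ ∧ g a₁ = a₂) := by
    clear e₁ e₂ e₃ e₄ e₅ e₆ e₇ e₈
    grind
  clear hg h e₉
  rcases cases with ⟨h₁, h₂⟩ | ⟨h₁, h₂⟩ | ⟨h₁, h₂⟩ | ⟨h₁, h₂⟩ <;>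
    simp only [h₁, h₂] at e₁ e₂ e₅ e₇ e₈ <;>
    clear ha₂ ha₁ ha₀ hb₂ hb₁ hb₀ <;> grind

theorem CondA.infIrred (hac : Acyclic f) (hf : CondA f) : InfIrred (single f) := by
  obtain ⟨a₀, a₁, a₂, b₀, b₁, b₂, hnd, ha₂, ha₁, ha₀, hb₂, hb₁, hb₀⟩ := hf
  have hnd' := hnd
  simp only [List.nodup_cons, List.mem_cons, List.not_mem_nil, or_false, not_or, List.nodup_nil,
    and_true, not_false_eq_true] at hnd'
  have hκ : ¬ Preserves f (pair a₂ a₁) := by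
    rw [preserves_pair]
    grind
  refine infIrred_of_separating hκ fun g hg hgκ => Dom.of_eq fun x => ?_
  rw [preserves_pair] at hgκ
  obtain ⟨⟨ga₂, ga₁, ga₀⟩, gb₂, gb₁, gb₀⟩ :=
    hg.eq_on_disjoint_tails hnd ha₂ ha₁ ha₀ hb₂ hb₁ hb₀ hgκ
  have hsucc : ∀ y, y ∈ tail f x → f y ∈ tail f x := fun y => apply_mem_tail
  have hx := mem_tail_self (f := f) x
  -- Each union is closed under `f`, and `a₀ ≠ b₀`, so together these place `g x` on the tail of
  -- `x`.
  have e₁ := hg.blocks₃ (tail f x ∪ {a₀}) (x := x) (y := a₀) (by grind) (by grind) (by grind)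
  have e₂ := hg.blocks₃ (tail f x ∪ {b₀}) (x := x) (y := b₀) (by grind) (by grind) (by grind)
  by_cases h : a₀ ∈ tail f x
  · have hb : b₀ ∉ tail f x := fun hb => by
      rcases mem_tail_or_mem_tail h hb with h | h
      · exact hnd'.1.2.2.1 (tail_of_fixed hb₀ h)
      · exact hnd'.1.2.2.1 (tail_of_fixed ha₀ h).symm
    refine hg.eq_of_tail hac hb₂ hb₁ hb₀ (by grind) gb₂ gb₁ gb₀
      (fun hb' => hb (hb₁ ▸ apply_mem_tail hb')) ?_
    grind
  · refine hg.eq_of_tail hac ha₂ ha₁ ha₀ (by grind) ga₂ ga₁ ga₀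
      (fun ha' => h (ha₁ ▸ apply_mem_tail ha')) ?_
    grind

theorem Dom.eq_on_joined_tails (hg : Dom f g) {c a₁ a₂ b₁ b₂ : A}
    (hnd : [c, a₁, a₂, b₁, b₂].Nodup) (ha₂ : f a₂ = a₁) (hb₂ : f b₂ = b₁) (hb₁ : f b₁ = c)
    (ha₁ : f a₁ = c) (hc : f c = c)
    (h : ¬ (g a₂ = g a₁ ∨ (g a₂ = a₂ ∨ g a₂ = a₁) ∧ (g a₁ = a₂ ∨ g a₁ = a₁))) :
    g a₂ = a₁ ∧ g a₁ = c ∧ g b₂ = b₁ ∧ g b₁ = c ∧ g c = c := by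
  simp only [List.nodup_cons, List.mem_cons, List.not_mem_nil, or_false, not_or, List.nodup_nil,
    and_true, not_false_eq_true] at hnd
  have hfa : f (f a₂) = c := by rw [ha₂, ha₁]
  have hfb : f (f b₂) = c := by rw [hb₂, hb₁]
  have e₁ := hg.apply_depth₂₂ hc hfa hfb (by grind) (by grind)
  have e₂ := hg.apply_depth₁₁ hc ha₁ hb₁ (by grind) (by grind)
  have e₈ := hg.apply_depth₂₁ hc hfa hb₁ (by grind) (by grind) (by grind)
  have e₄ := hg.apply_edge hc hfb
  have e₅ := hg.apply_depth₁ hc ha₁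
  have e₆ := hg.apply_depth₁ hc hb₁
  have e₉ := hg.apply_edge hc hfa
  simp only [ha₂, hb₂] at e₁ e₄ e₈ e₉
  have cases : (g a₂ = a₁ ∧ g a₁ = c) ∨ (g a₂ = c ∧ g a₁ = a₁) ∨ (g a₂ = a₂ ∧ g a₁ = c) ∨
      (g a₂ = c ∧ g a₁ = a₂) := by
    clear e₁ e₂ e₄ e₅ e₆ e₈
    grind
  clear hg h e₉
  rcases cases with ⟨h₁, h₂⟩ | ⟨h₁, h₂⟩ | ⟨h₁, h₂⟩ | ⟨h₁, h₂⟩ <;>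
    simp only [h₁, h₂] at e₁ e₂ e₅ e₈ <;>
    clear ha₂ hb₂ hb₁ ha₁ hc hfa hfb <;> grind

theorem CondB.infIrred (hac : Acyclic f) (hf : CondB f) : InfIrred (single f) := by
  obtain ⟨hconn, c, a₁, a₂, b₁, b₂, hnd, ha₂, hb₂, hb₁, ha₁, hc⟩ := hf
  have hnd' := hnd
  simp only [List.nodup_cons, List.mem_cons, List.not_mem_nil, or_false, not_or, List.nodup_nil,
    and_true, not_false_eq_true] at hnd'
  have hκ : ¬ Preserves f (pair a₂ a₁) := by
    rw [preserves_pair]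
    grind
  refine infIrred_of_separating hκ fun g hg hgκ => Dom.of_eq fun x => ?_
  rw [preserves_pair] at hgκ
  obtain ⟨ga₂, ga₁, gb₂, gb₁, gc⟩ := hg.eq_on_joined_tails hnd ha₂ hb₂ hb₁ ha₁ hc hgκ
  have hcx : c ∈ tail f x := by
    obtain ⟨i, j, hij⟩ := hconn x c
    exact ⟨i, hij.trans (Function.iterate_fixed hc j)⟩
  have hsucc : ∀ y, y ∈ tail f x → f y ∈ tail f x := fun y => apply_mem_tail
  have hx := mem_tail_self (f := f) x
  have hgx : g x ∈ tail f x := by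
    have := hg.blocks₃ (tail f x) hx hcx hsucc
    grind
  have htail : ∀ y z, y ∈ tail f z → f z = c → y = z ∨ y = c := fun y z hy hz => by
    rcases mem_tail_iff.1 hy with h | h
    · exact Or.inl h
    · rw [hz] at h
      exact Or.inr (tail_of_fixed hc h)
  -- No tail contains both `a₁` and `b₁`: one would lie on the tail of the other, but both are one
  -- step from `c`.
  by_cases h : a₁ ∈ tail f x
  · refine hg.eq_of_tail hac hb₂ hb₁ hc (by grind) gb₂ gb₁ gc (fun hb => ?_) hgx
    rcases mem_tail_or_mem_tail h hb with h | h
    · have := htail _ _ h hb₁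
      grind
    · have := htail _ _ h ha₁
      grind
  · exact hg.eq_of_tail hac ha₂ ha₁ hc (by grind) ga₂ ga₁ gc h hgx

/-! ### Reducible maps -/

theorem Acyclic.exists_tail (hf : Acyclic f) {x : A} (hx : f (f x) ≠ f x) :
    ∃ a ∈ tail f x, f (f a) ≠ f a ∧ f (f (f a)) = f (f a) := by
  classical
  obtain ⟨n, hn, hmin⟩ : ∃ n, f^[n] x = f^[n + 1] x ∧ ∀ m < n, f^[m] x ≠ f^[m + 1] x :=
    ⟨Nat.find (hf x), Nat.find_spec (hf x), fun m hm => Nat.find_min (hf x) hm⟩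
  -- The least `n` is the depth of `x`, at least two by `hx`; the point sought is two steps before
  -- the fixed point.
  match n with
  | 0 => exact absurd (congrArg f hn.symm) hx
  | 1 => exact absurd hn.symm hx
  | n + 2 =>
    have := hmin (n + 1) (by omega)
    simp only [Function.iterate_succ_apply'] at this hn
    exact ⟨f^[n] x, ⟨n, rfl⟩, this.symm, hn.symm⟩

/-- To check that `κ` is preserved it suffices to check pairs separated by a predicate,
besides those on which the predicate is constant. -/
theorem Preserves.of_cases {κ : Setoid A} (P : A → Prop)
    (h₁ : ∀ u v, κ u v → P u → P v → κ (f u) (f v))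
    (h₂ : ∀ u v, κ u v → ¬ P u → ¬ P v → κ (f u) (f v))
    (h₃ : ∀ u v, κ u v → P u → ¬ P v → κ (f u) (f v)) : Preserves f κ := by
  intro u v h
  by_cases hu : P u <;> by_cases hv : P v
  · exact h₁ u v h hu hv
  · exact h₃ u v h hu hv
  · exact κ.symm (h₃ v u (κ.symm h) hv hu)
  · exact h₂ u v h hu hv

/-- One map keeps `f` on the component of `c = f (f a)`, the other keeps it off that component; both
are `c` elsewhere. A congruence of `f` linking `v` outside to the component relates `f v` to `c`:
iterate until the inner point reaches `c`, while `f v` stays fixed. -/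
theorem not_infIrred_of_other_component {a y : A} (ha₁ : f (f a) ≠ f a)
    (ha₀ : f (f (f a)) = f (f a)) (hy : f (f a) ∉ tail f y)
    (h : ∀ y, f (f a) ∉ tail f y → f (f y) = f y) : ¬ InfIrred (single f) := by
  classical
  obtain ⟨c, hc⟩ : ∃ c, c = f (f a) := ⟨_, rfl⟩
  rw [← hc] at ha₁ ha₀ hy
  simp only [← hc] at h
  have hne : a ≠ c := by grind
  have hne' : a ≠ f a := by grind
  have hca : c ∈ tail f a := ⟨2, hc.symm⟩
  have hcfa : c ∈ tail f (f a) := ⟨1, hc.symm⟩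
  have hcfy : c ∉ tail f (f y) := fun h' => hy (mem_tail_iff.2 (Or.inr h'))
  have hffy := h y hy
  have hcy : c ≠ f y := fun h' => hcfy (h' ▸ mem_tail_self _)
  have key : ∀ κ : Setoid A, Preserves f κ → ∀ u v, κ u v → c ∈ tail f u → c ∉ tail f v →
      κ (f v) c := fun κ hκ u v huv ⟨n, hn⟩ hv => by
    have hn' : f^[n] u = c := hn
    have h' := hκ.iterate (n + 1) u v huv
    rw [Function.iterate_succ_apply', hn', Function.iterate_succ_apply f n v,
      Function.iterate_fixed (h v hv), ha₀] at h'
    exact κ.symm h'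
  refine not_infIrred_of_two (g₁ := fun x => if c ∈ tail f x then f x else c)
    (g₂ := fun x => if c ∈ tail f x then c else f x) ?_ ?_ ?_ ?_ ?_
  · intro κ hκ
    refine Preserves.of_cases (fun x => c ∈ tail f x) ?_ ?_ ?_ <;> intro u v huv hu hv <;>
      simp only [hu, hv, if_true, if_false]
    · exact hκ u v huv
    · exact κ.refl c
    · exact κ.trans (hκ u v huv) (key κ hκ u v huv hu hv)
  · intro κ hκ
    refine Preserves.of_cases (fun x => c ∈ tail f x) ?_ ?_ ?_ <;> intro u v huv hu hv <;>
      simp only [hu, hv, if_true, if_false]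
    · exact κ.refl c
    · exact hκ u v huv
    · exact κ.symm (key κ hκ u v huv hu hv)
  · intro hdom
    have := hdom (pair (f a) (f y)) (preserves_pair.2 (by simp only [hcfa, hcfy]; grind))
    rw [preserves_pair] at this
    grind
  · intro hdom
    have := hdom (pair a (f a)) (preserves_pair.2 (by simp only [hca, hcfa]; grind))
    rw [preserves_pair] at this
    grind
  · intro κ h₁ h₂
    refine Preserves.of_cases (fun x => c ∈ tail f x) ?_ ?_ ?_ <;> intro u v huv hu hv
    · simpa only [hu, hv, if_true] using h₁ u v huv
    · simpa only [hu, hv, if_false] using h₂ u v huv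
    · have e₁ := h₁ u v huv
      have e₂ := h₂ u v huv
      simp only [hu, hv, if_true, if_false] at e₁ e₂
      exact κ.trans e₁ e₂

/-- With `d = f a`, the maps modify `f` by sending either the points with image `c` or all the
others to `d`. By `huniq`, the path from any image other than `c` passes through `d`, so a
congruence of `f` relating points of the two kinds also relates `c` to `d`. -/
theorem not_infIrred_of_deep (hac : Acyclic f) {a x : A} (ha₁ : f (f a) ≠ f a)
    (ha₀ : f (f (f a)) = f (f a)) (hconn : ∀ y, f (f a) ∈ tail f y)
    (huniq : ∀ b, f (f b) = f (f a) → f b ≠ f (f a) → f b = f a) (hx : f (f x) ≠ f (f a)) :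
    ¬ InfIrred (single f) := by
  classical
  obtain ⟨c, hc⟩ : ∃ c, c = f (f a) := ⟨_, rfl⟩
  obtain ⟨d, hd⟩ : ∃ d, d = f a := ⟨_, rfl⟩
  rw [← hc] at ha₁ ha₀ hx
  rw [← hd] at ha₁ hc
  simp only [← hd] at huniq hconn
  simp only [← hc] at huniq hconn
  have hiter : ∀ n w, f^[n] (f w) = c → f w ≠ c → d ∈ tail f (f w) := fun n => by
    induction n with
    | zero => exact fun w h h' => absurd h h'
    | succ n ih =>
      intro w h h'
      by_cases hw : f (f w) = c
      · rw [huniq w hw h']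
        exact mem_tail_self d
      · exact mem_tail_iff.2 (Or.inr (ih (f w) h hw))
  have key : ∀ κ : Setoid A, Preserves f κ → ∀ u v, κ u v → f u = c → f v ≠ c → κ c d :=
    fun κ hκ u v huv hu hv => by
      obtain ⟨m, hm⟩ := hconn (f v)
      obtain ⟨n, hn⟩ := hiter m v hm hv
      have hn' : f^[n] (f v) = d := hn
      have h' := hκ.iterate n _ _ (hκ u v huv)
      rwa [hu, hn', Function.iterate_fixed ha₀] at h'
  have hfd : f d = c := hc.symm
  have hfix : ∀ w, f w = w → w = c := fun w hw => (tail_of_fixed hw (hconn w)).symm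
  have hxx := hac.fixed_of_iterate_eq (x := x) (n := 2) (by norm_num)
  have hxf := hfix (f x)
  have hxf' := hfix x
  change f (f x) = x → _ at hxx
  refine not_infIrred_of_two (g₁ := fun x => if f x = c then d else f x)
    (g₂ := fun x => if f x = c then c else d) ?_ ?_ ?_ ?_ ?_
  · intro κ hκ
    refine Preserves.of_cases (fun x => f x = c) ?_ ?_ ?_ <;> intro u v huv hu hv <;>
      simp only [hu, hv, if_true, if_false]
    · exact κ.refl d
    · exact hκ u v huv
    · have := hκ u v huv
      rw [hu] at this
      exact κ.trans (κ.symm (key κ hκ u v huv hu hv)) this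
  · intro κ hκ
    refine Preserves.of_cases (fun x => f x = c) ?_ ?_ ?_ <;> intro u v huv hu hv <;>
      simp only [hu, hv, if_true, if_false]
    · exact κ.refl c
    · exact κ.refl d
    · exact key κ hκ u v huv hu hv
  · intro hdom
    have := hdom (pair a d) (preserves_pair.2 (by grind))
    rw [preserves_pair] at this
    grind
  · intro hdom
    have := hdom (pair x (f x)) (preserves_pair.2 (by grind))
    rw [preserves_pair] at this
    grind
  · intro κ h₁ h₂
    refine Preserves.of_cases (fun x => f x = c) ?_ ?_ ?_ <;> intro u v huv hu hv
    · rw [hu, hv]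
    · simpa only [hu, hv, if_false] using h₁ u v huv
    · have e₁ := h₁ u v huv
      have e₂ := h₂ u v huv
      simp only [hu, hv, if_true, if_false] at e₁ e₂
      rw [hu]
      exact κ.trans e₂ e₁

/-- Here `f` takes only the values `c` and `d`. The two maps are the identity off the kernel class
`{c, d}` and collapse it to `c` or to `d`. Relating a point `v` outside the class to one inside
amounts, for `f` as for the two maps together, to relating `v` to both `c` and `d`. -/
theorem not_infIrred_of_small_kernel_class {a : A} (ha₁ : f (f a) ≠ f a)
    (hff : ∀ x, f (f x) = f (f a)) (hker : ∀ x, f x = f (f a) → x = f a ∨ x = f (f a)) :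
    ¬ InfIrred (single f) := by
  classical
  obtain ⟨c, hc⟩ : ∃ c, c = f (f a) := ⟨_, rfl⟩
  obtain ⟨d, hd⟩ : ∃ d, d = f a := ⟨_, rfl⟩
  rw [← hc] at ha₁
  rw [← hd] at ha₁ hc
  simp only [← hd] at hff hker
  simp only [← hc] at hff hker
  have hfd : f d = c := hc.symm
  have hfc : f c = c := (congrArg f hc).trans (hff d)
  have himg : ∀ x, f x ≠ c → f x = d := fun x hx => (hker (f x) (hff x)).resolve_right hx
  have key : ∀ κ : Setoid A, Preserves f κ → ∀ u v, κ u v → f u = c → f v ≠ c →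
      κ c v ∧ κ d v := fun κ hκ u v huv hu hv => by
    have h := hκ u v huv
    rw [hu, himg v hv] at h
    rcases hker u hu with rfl | rfl
    · exact ⟨κ.trans h huv, huv⟩
    · exact ⟨huv, κ.trans (κ.symm h) huv⟩
  refine not_infIrred_of_two (g₁ := fun x => if f x = c then c else x)
    (g₂ := fun x => if f x = c then d else x) ?_ ?_ ?_ ?_ ?_
  · intro κ hκ
    refine Preserves.of_cases (fun x => f x = c) ?_ ?_ ?_ <;> intro u v huv hu hv <;>
      simp only [hu, hv, if_true, if_false]
    · exact κ.refl c
    · exact huv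
    · exact (key κ hκ u v huv hu hv).1
  · intro κ hκ
    refine Preserves.of_cases (fun x => f x = c) ?_ ?_ ?_ <;> intro u v huv hu hv <;>
      simp only [hu, hv, if_true, if_false]
    · exact κ.refl d
    · exact huv
    · exact (key κ hκ u v huv hu hv).2
  · intro hdom
    have := hdom (pair a c) (preserves_pair.2 (by grind))
    rw [preserves_pair] at this
    grind
  · intro hdom
    have := hdom (pair a d) (preserves_pair.2 (by grind))
    rw [preserves_pair] at this
    grind
  · intro κ h₁ h₂
    refine Preserves.of_cases (fun x => f x = c) ?_ ?_ ?_ <;> intro u v huv hu hv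
    · rw [hu, hv]
    · rw [himg u hu, himg v hv]
    · have e₁ := h₁ u v huv
      have e₂ := h₂ u v huv
      simp only [hu, hv, if_true, if_false] at e₁ e₂
      rw [hu, himg v hv]
      exact κ.trans e₁ (κ.symm e₂)

/-! ### Case distinction and the main equivalence -/

theorem exists_condition_of_infIrred (hac : Acyclic f) (h : InfIrred (single f)) :
    TypeI f ∨ TypeII f ∨ CondA f ∨ CondB f := by
  have hnt : ¬ Trivial f := fun ht => not_infIrred_of_trivial ht h
  by_cases hff : ∀ x, f (f x) = f x
  · exact Or.inl ⟨hnt, hff⟩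
  simp only [not_forall] at hff
  obtain ⟨x, hx⟩ := hff
  obtain ⟨a, -, ha₁, ha₀⟩ := hac.exists_tail hx
  have hne : a ≠ f a := by grind
  have hne' : a ≠ f (f a) := by grind
  by_cases hconn : ∀ y, f (f a) ∈ tail f y
  swap
  · simp only [not_forall] at hconn
    obtain ⟨y, hy⟩ := hconn
    by_cases hout : ∀ y, f (f a) ∉ tail f y → f (f y) = f y
    · exact absurd h (not_infIrred_of_other_component ha₁ ha₀ hy hout)
    · simp only [not_forall] at hout
      obtain ⟨w, hw, hw'⟩ := hout
      obtain ⟨b, hb, hb₁, hb₀⟩ := hac.exists_tail hw'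
      have hout : ∀ v, v ∈ tail f w → v ≠ f (f a) ∧ f v ∈ tail f w :=
        fun v hv => ⟨fun h => hw (h ▸ hv), apply_mem_tail hv⟩
      have hout₀ := hout b hb
      have hout₁ := hout _ hout₀.2
      have hout₂ := hout _ hout₁.2
      refine Or.inr (Or.inr (Or.inl
        ⟨f (f a), f a, a, f (f b), f b, b, ?_, rfl, rfl, ha₀, rfl, rfl, hb₀⟩))
      clear hout
      simp only [List.nodup_cons, List.mem_cons, List.not_mem_nil, or_false, not_or,
        List.nodup_nil, and_true, not_false_eq_true]
      grind
  -- Failing (b), every depth-one point with a preimage equals `f a`, since a second one would start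
  -- another tail into `f (f a)`.
  · have huniq_or : CondB f ∨ ∀ b, f (f b) = f (f a) → f b ≠ f (f a) → f b = f a := by
      by_contra! hno
      obtain ⟨hB, b, hb, hb', hb''⟩ := hno
      refine hB ⟨fun x y => ?_, f (f a), f a, a, f b, b, ?_, rfl, rfl, hb, rfl, ha₀⟩
      · obtain ⟨i, hi⟩ := hconn x
        obtain ⟨j, hj⟩ := hconn y
        exact ⟨i, j, hi.trans hj.symm⟩
      · simp only [List.nodup_cons, List.mem_cons, List.not_mem_nil, or_false, not_or,
          List.nodup_nil, and_true, not_false_eq_true]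
        grind
    rcases huniq_or with hB | huniq
    · exact Or.inr (Or.inr (Or.inr hB))
    by_cases hdeep : ∀ x, f (f x) = f (f a)
    swap
    · simp only [not_forall] at hdeep
      obtain ⟨x, hx⟩ := hdeep
      exact absurd h (not_infIrred_of_deep hac ha₁ ha₀ hconn huniq hx)
    by_cases hker : ∀ x, f x = f (f a) → x = f a ∨ x = f (f a)
    · exact absurd h (not_infIrred_of_small_kernel_class ha₁ hdeep hker)
    · push Not at hker
      obtain ⟨x, hx, hxa, hxa'⟩ := hker
      refine Or.inr (Or.inl ⟨hnt, f (f a), hdeep, ?_⟩)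
      have hsub : ({x, f a, f (f a)} : Set A) ⊆ {x | f x = f (f (f a))} := by
        rintro y (rfl | rfl | rfl)
        · exact hx.trans ha₀.symm
        · exact ha₀.symm
        · rfl
      refine le_trans ?_ (Set.encard_le_encard hsub)
      rw [Set.encard_eq_three.2 ⟨x, f a, f (f a), hxa, hxa', ha₁.symm, rfl⟩]

end MonounaryCon

theorem theorem5p4 {A : Type*} [Finite A] (f : A → A) (hf : MonounaryCon.Acyclic f) :
    InfIrred (MonounaryCon.CongLattices.single f) ↔
      MonounaryCon.TypeI f ∨ MonounaryCon.TypeII f ∨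
        MonounaryCon.CondA f ∨ MonounaryCon.CondB f := by
  refine ⟨MonounaryCon.exists_condition_of_infIrred hf, ?_⟩
  rintro (h | h | h | h)
  · exact h.infIrred
  · exact h.infIrred
  · exact h.infIrred hf
  · exact h.infIrred hf
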